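/- For a subset $R$ of a finite additive group $Z$ and a real number $\alpha>0$, say that $R$ is $(\alpha,3AP)$-dense if every subset $A\subseteq R$ with $|A|\ge \alpha|R|$ contains a nontrivial three-term arithmetic progression, that is, elements $x,\ x+d,\ x+2d$ of $A$ with $d\neq 0$. Theorem. For every $\alpha>0$ there is a constant $C=C(\alpha)>0$ such that the following holds for every fixed odd prime $p$. Put $V=\mathbb{F}_p^n$. As $n\to\infty$, if $R$ is chosen uniformly at random among all $r$-element subsets of $V$, then the probability that $R$ fails to be $(\alpha,3AP)$-dense is $o(1)$, uniformly over all integers $r$ with $C(\alpha)\,|V|^{1/2}\le r\le |V|$. In other words, for every $\varepsilon>0$ there is $n_0=n_0(\alpha,p,\varepsilon)$ such that for all $n\ge n_0$ and all such $r$ this probability is at most $\varepsilon$. -/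

import Mathlib

/-- A finite subset `R` of an additive group `Z` is `(α, 3AP)`-dense if every `A ⊆ R` with
`|A| ≥ α |R|` contains a nontrivial three-term arithmetic progression. Mathlib's `ThreeAPFree A`
says that `a + c = b + b` with `a, b, c ∈ A` forces `a = b`, so its negation provides
`a, b, c ∈ A` of the form `a, a + d, a + 2d` with `d ≠ 0`. -/
def IsThreeAPDense {Z : Type*} [AddCommGroup Z] (α : ℝ) (R : Finset Z) : Prop :=
  ∀ A : Finset Z, A ⊆ R → α * (R.card : ℝ) ≤ (A.card : ℝ) → ¬ ThreeAPFree (A : Set Z)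

/-- The probability that a uniformly random `r`-element subset `R` of the finite additive group `Z`
fails to be `(α, 3AP)`-dense: the proportion of such `R` among all `r`-element subsets of `Z`. -/
noncomputable def probNotThreeAPDense (Z : Type*) [AddCommGroup Z] [Fintype Z]
    (α : ℝ) (r : ℕ) : ℝ :=
  open Classical in
  ((((Finset.univ : Finset Z).powersetCard r).filter
      (fun R : Finset Z => ¬ IsThreeAPDense α R)).card : ℝ) /
    (((Finset.univ : Finset Z).powersetCard r).card : ℝ)

namespace RandomRoth

open Finset SimpleGraph SimpleGraph.TripartiteFromTriangles Sum3

/-! A first-moment argument. If `R` fails, it contains a progression-free set of size m = ⌈αr⌉, so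
it suffices that such sets are rare: at most (4η)^m C(N,m) of them among N points, for any fixed η ≤
1 and m ≥ L(η)√N (`card_threeAPFree_le`).

Rarity comes from containers. Triangle removal gives a dense `W` of the order of N² progressions.
For a progression-free I ⊆ W, about √N well-chosen elements of I therefore determine a positive
proportion of N points that the rest of I misses (`exists_container_step`). Boundedly many
iterations confine I to a fingerprint of size O(√N) plus a container of density at most β
(`exists_containers`). Counting fingerprints, containers and the remaining points gives the bound.
Only injectivity of doubling and N large are needed, so the constant does not depend on p. -/

/-! ### Supersaturation from triangle removal. -/

/-- Varnavides' form of Roth's theorem. -/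
theorem card_threeAP_ge {G : Type*} [AddCommGroup G] [Fintype G] [DecidableEq G]
    (h2 : Function.Injective fun x : G => x + x) {β : ℝ} {A : Finset G}
    (hA : β * Fintype.card G ≤ #A) :
    triangleRemovalBound (β / 9) * 27 * (Fintype.card G : ℝ) ^ 2 ≤
      #{x ∈ A ×ˢ A | x.1 + x.1 - x.2 ∈ A} := by
  rcases isEmpty_or_nonempty G with hG | hG
  · simp
  let f : G × G ↪ G × G × G :=
    ⟨fun x => (x.1, x.1 + x.2, x.1 + x.2 + x.2), by
      rintro ⟨x, a⟩ ⟨y, b⟩ h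
      simp only [Prod.mk.injEq] at h
      obtain ⟨rfl, h, -⟩ := h
      simpa using h⟩
  let t : Finset (G × G × G) := (univ ×ˢ A).map f
  have mem_t : ∀ x y z, (x, y, z) ∈ t ↔ ∃ a ∈ A, y = x + a ∧ z = x + a + a := by
    intro x y z
    simp only [t, f, mem_map, mem_product, mem_univ, true_and, Prod.exists]
    constructor
    · rintro ⟨x, a, ha, ⟨⟩⟩
      exact ⟨a, ha, rfl, rfl⟩
    · rintro ⟨a, ha, rfl, rfl⟩
      exact ⟨x, a, ha, rfl⟩
  have : ExplicitDisjoint t := by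
    constructor
    · intro x y z x' h h'
      obtain ⟨a, -, rfl, rfl⟩ := (mem_t _ _ _).1 h
      obtain ⟨b, -, hb, hb'⟩ := (mem_t _ _ _).1 h'
      rw [← hb] at hb'
      obtain rfl := add_left_cancel hb'
      exact add_right_cancel hb
    · intro x y z y' h h'
      obtain ⟨a, -, rfl, rfl⟩ := (mem_t _ _ _).1 h
      obtain ⟨b, -, rfl, hb⟩ := (mem_t _ _ _).1 h'
      rw [add_assoc, add_assoc] at hb
      rw [h2 (add_left_cancel hb)]
    · intro x y z z' h h'
      obtain ⟨a, -, rfl, rfl⟩ := (mem_t _ _ _).1 h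
      obtain ⟨b, -, hb, rfl⟩ := (mem_t _ _ _).1 h'
      rw [add_left_cancel hb]
  -- The graph has 3N vertices, and (β/9)(3N)² = βN² is at most the number N·#A of edge-disjoint
  -- triangles in `t`.
  have hfar : (graph t).FarFromTriangleFree (β / 9) := by
    refine farFromTriangleFree t ?_
    have ht : (#t : ℝ) = Fintype.card G * #A := by simp [t]
    rw [ht]
    push_cast
    have : (0 : ℝ) ≤ Fintype.card G := by positivity
    nlinarith [mul_le_mul_of_nonneg_left hA this]
  have h₁ := hfar.le_card_cliqueFinset
  let P : Finset (G × G) := {x ∈ A ×ˢ A | x.1 + x.1 - x.2 ∈ A}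
  -- The edge labels u, v, w of any triangle satisfy u + w = 2v, so a base point and a progression
  -- determine it.
  have hsub : (graph t).cliqueFinset 3 ⊆ ((univ : Finset G) ×ˢ P).image
      fun u => {in₀ u.1, in₁ (u.1 + u.2.2), in₂ (u.1 + u.2.1 + u.2.1)} := by
    intro s hs
    rw [mem_cliqueFinset_iff, is3Clique_iff] at hs
    obtain ⟨x, y, z, hxy, hxz, hyz, rfl⟩ := hs
    obtain ⟨a, b, c, habc, hab, hac, hbc⟩ := graph_triple hxy hxz hyz
    rw [Graph.in₀₁_iff] at hab
    rw [Graph.in₀₂_iff] at hac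
    rw [Graph.in₁₂_iff] at hbc
    simp only [mem_t] at hab hac hbc
    obtain ⟨-, u, hu, rfl, -⟩ := hab
    obtain ⟨-, v, hv, -, rfl⟩ := hac
    obtain ⟨w', w, hw, h₁, h₂⟩ := hbc
    refine mem_image.2 ⟨(a, v, u), ?_, habc⟩
    simp only [P, mem_product, mem_univ, true_and, mem_filter]
    refine ⟨⟨hv, hu⟩, ?_⟩
    rw [← h₁, add_assoc, add_assoc, add_right_inj] at h₂
    rw [h₂, add_sub_cancel_left]
    exact hw
  have h₃ : (#((graph t).cliqueFinset 3) : ℝ) ≤ Fintype.card G * #P := by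
    have := (card_le_card hsub).trans card_image_le
    rw [card_product, card_univ] at this
    exact_mod_cast this
  have hN : (0 : ℝ) < Fintype.card G := by exact_mod_cast Fintype.card_pos
  have h₄ := h₁.trans h₃
  simp only [Fintype.card_sum] at h₄
  push_cast at h₄
  refine le_of_mul_le_mul_left (le_of_eq_of_le ?_ h₄) hN
  ring

/-! ### One step of the container algorithm. -/

section Containers

variable {G : Type*} [AddCommGroup G] [DecidableEq G]

/-- The midpoints `b` of the nontrivial progressions in `W` starting at `a`. -/
def link (W : Finset G) (a : G) : Finset G := {b ∈ W | b ≠ a ∧ b + b - a ∈ W}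

/-- The midpoints `y ∈ W` of the nontrivial progressions joining `z` to an element of `S`. -/
def nbhd (W S : Finset G) (z : G) : Finset G := {y ∈ W | y ≠ z ∧ y + y - z ∈ S}

/-- The elements of `W` that are excluded from a progression-free set containing `S` and `T`, when
`T` is saturated in the sense that no further element of the set has `t` new neighbours. -/
noncomputable def excluded (W : Finset G) (t : ℝ) (S T : Finset G) : Finset G :=
  T.biUnion (nbhd W S) ∪ {z ∈ W | t ≤ (#(nbhd W S z \ T.biUnion (nbhd W S)) : ℝ)}

theorem card_filter_le_sum_link (W : Finset G) :
    #{x ∈ W ×ˢ W | x.1 + x.1 - x.2 ∈ W} ≤ ∑ a ∈ W, #(link W a) + #W := by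
  rw [card_filter, sum_product_right, card_eq_sum_ones W, ← sum_add_distrib]
  refine sum_le_sum fun a _ => ?_
  rw [← card_filter]
  refine (card_le_card (t := insert a (link W a)) fun b hb => ?_).trans (card_insert_le _ _)
  rw [mem_filter] at hb
  rw [mem_insert, link, mem_filter]
  tauto

/-- Popularity principle: a large sum of bounded terms forces many large terms. It yields both the
popular starting points and the z with many new neighbours. -/
theorem sum_le_card_filter_mul {ι : Type*} (s : Finset ι) (f : ι → ℕ) {M t : ℝ}
    (ht : 0 ≤ t) (hf : ∀ i ∈ s, (f i : ℝ) ≤ M) :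
    (∑ i ∈ s, (f i : ℝ)) ≤ #{i ∈ s | t ≤ (f i : ℝ)} * M + #s * t := by
  rw [← sum_filter_add_sum_filter_not s (fun i => t ≤ (f i : ℝ))]
  refine add_le_add ?_ ?_
  · rw [← nsmul_eq_mul]
    exact sum_le_card_nsmul _ _ _ fun i hi => hf i (mem_filter.1 hi).1
  · calc (∑ i ∈ s with ¬ t ≤ (f i : ℝ), (f i : ℝ)) ≤ #{i ∈ s | ¬ t ≤ (f i : ℝ)} • t :=
          sum_le_card_nsmul _ _ _ fun i hi => (not_le.1 (mem_filter.1 hi).2).le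
      _ ≤ #s * t := by
          rw [nsmul_eq_mul]
          gcongr
          exact filter_subset _ _

/-- Both sides count progressions z, y, s; for fixed y, the reflection z ↦ 2y - z exchanges the
endpoints. -/
theorem sum_card_nbhd (W S : Finset G) :
    ∑ z ∈ W, #(nbhd W S z) = ∑ s ∈ S, #(link W s) := by
  simp only [nbhd, link, card_filter]
  rw [sum_comm, sum_comm (s := S)]
  refine sum_congr rfl fun y _ => ?_
  simp only [← card_filter]
  refine card_nbij' (fun z => y + y - z) (fun z => y + y - z) ?_ ?_ ?_ ?_
  · intro z hz
    simp only [coe_filter, Set.mem_ofPred_eq] at hz ⊢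
    refine ⟨hz.2.2, fun h => hz.2.1 ?_, by simpa using hz.1⟩
    rw [eq_sub_iff_add_eq] at h
    exact (add_left_cancel h).symm
  · intro z hz
    simp only [coe_filter, Set.mem_ofPred_eq] at hz ⊢
    refine ⟨hz.2.2, fun h => hz.2.1 ?_, by simpa using hz.1⟩
    rw [eq_sub_iff_add_eq] at h
    exact (add_left_cancel h).symm
  · intro z _
    simp
  · intro z _
    simp

theorem card_nbhd_le (h2 : Function.Injective fun x : G => x + x) (W S : Finset G) (z : G) :
    #(nbhd W S z) ≤ #S := by
  refine card_le_card_of_injOn (fun y => y + y - z) (fun y hy => (mem_filter.1 hy).2.2) ?_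
  intro x _ y _ h
  exact h2 (sub_left_injective h)

theorem card_filter_mem_nbhd_le (W S : Finset G) (y : G) :
    #{z ∈ W | y ∈ nbhd W S z} ≤ #S := by
  refine card_le_card_of_injOn (fun z => y + y - z)
    (fun z hz => (mem_filter.1 (mem_filter.1 hz).2).2.2) ?_
  intro x _ z _ h
  exact sub_right_injective h

theorem sum_card_nbhd_inter_le (W S B : Finset G) :
    ∑ z ∈ W, #(nbhd W S z ∩ B) ≤ #B * #S := by
  have h : ∀ z, #(nbhd W S z ∩ B) = ∑ y ∈ B, if y ∈ nbhd W S z then 1 else 0 := by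
    intro z
    rw [← card_filter, inter_comm, filter_mem_eq_inter]
  simp only [h]
  rw [sum_comm, ← smul_eq_mul]
  refine sum_le_card_nsmul _ _ _ fun y _ => ?_
  rw [← card_filter]
  exact card_filter_mem_nbhd_le W S y

/-- A neighbour of `T` is the midpoint of a progression with endpoints in `T` and `S`; the other
excluded points contradict saturation. -/
theorem disjoint_excluded {W S T I : Finset G} {t : ℝ} (hI : ThreeAPFree (I : Set G))
    (hS : S ⊆ I) (hT : T ⊆ I)
    (hsat : ∀ z ∈ I, (#(nbhd W S z \ T.biUnion (nbhd W S)) : ℝ) < t) :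
    Disjoint I (excluded W t S T) := by
  rw [Finset.disjoint_left]
  intro y hy hyD
  rw [excluded, mem_union, mem_biUnion, mem_filter] at hyD
  rcases hyD with ⟨z, hz, hyz⟩ | ⟨-, h⟩
  · rw [nbhd, mem_filter] at hyz
    obtain ⟨-, hne, hs⟩ := hyz
    have h := hI (hS hs) hy (hT hz) (by simp)
    rw [sub_eq_iff_eq_add] at h
    exact hne (add_left_cancel h)
  · exact (hsat y hy).not_ge h

/-- Greedy choice: a largest `T` whose elements contribute on average `t` neighbours cannot be
extended. -/
theorem exists_saturated (W S I : Finset G) {t : ℝ} (ht : 0 < t) :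
    ∃ T ⊆ I, (#T : ℝ) * t ≤ #(T.biUnion (nbhd W S)) ∧
      ∀ z ∈ I, (#(nbhd W S z \ T.biUnion (nbhd W S)) : ℝ) < t := by
  obtain ⟨T, hT, hmax⟩ := exists_max_image
    {T ∈ I.powerset | (#T : ℝ) * t ≤ #(T.biUnion (nbhd W S))} card
    ⟨∅, by simp⟩
  simp only [mem_filter, mem_powerset] at hT hmax
  refine ⟨T, hT.1, hT.2, fun z hz => ?_⟩
  by_contra! h
  have hzT : z ∉ T := fun hzT => by
    rw [sdiff_eq_empty_iff_subset.2 (subset_biUnion_of_mem _ hzT)] at h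
    simp only [card_empty, Nat.cast_zero] at h
    exact ht.not_ge h
  have := hmax (insert z T) ⟨insert_subset hz hT.1, ?_⟩
  · rw [card_insert_of_notMem hzT] at this
    omega
  · rw [card_insert_of_notMem hzT, biUnion_insert, ← sdiff_union_self_eq_union,
      card_union_of_disjoint sdiff_disjoint]
    push_cast
    linarith [hT.2]

/-- If the neighbourhood B of `T` is small, few of the τN·#S edges end in B, since each y has at
most #S partners z. The other edges force many z to have many neighbours outside B. -/
theorem card_excluded_ge [Fintype G] (h2 : Function.Injective fun x : G => x + x)
    {W S : Finset G} (hS0 : S.Nonempty) {τ : ℝ} (hτ : 0 ≤ τ)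
    (hlink : ∀ s ∈ S, τ * Fintype.card G ≤ #(link W s)) (T : Finset G) :
    τ / 4 * Fintype.card G ≤ #(excluded W (τ / 2 * #S) S T) := by
  set B := T.biUnion (nbhd W S) with hB
  set N : ℝ := (Fintype.card G : ℝ)
  have hq : (0 : ℝ) < #S := by exact_mod_cast hS0.card_pos
  rcases le_or_gt (τ / 4 * N) #B with h | h
  · refine h.trans ?_
    exact_mod_cast card_le_card (subset_union_left)
  have h1 : #S * (τ * N) ≤ ∑ z ∈ W, (#(nbhd W S z) : ℝ) := by
    rw [← Nat.cast_sum, sum_card_nbhd, Nat.cast_sum, ← nsmul_eq_mul]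
    exact card_nsmul_le_sum _ _ _ hlink
  have h3 : (∑ z ∈ W, (#(nbhd W S z) : ℝ)) =
      ∑ z ∈ W, (#(nbhd W S z \ B) : ℝ) + ∑ z ∈ W, (#(nbhd W S z ∩ B) : ℝ) := by
    rw [← sum_add_distrib]
    refine sum_congr rfl fun z _ => ?_
    exact_mod_cast (card_sdiff_add_card_inter _ _).symm
  have h4 : (∑ z ∈ W, (#(nbhd W S z ∩ B) : ℝ)) ≤ #B * #S := by
    exact_mod_cast sum_card_nbhd_inter_le W S B
  have h5 := sum_le_card_filter_mul W (fun z => #(nbhd W S z \ B)) (M := #S)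
    (t := τ / 2 * #S) (by positivity) fun z _ => by
      exact_mod_cast (card_le_card sdiff_subset).trans (card_nbhd_le h2 W S z)
  have h6 : (#W : ℝ) ≤ N := Nat.cast_le.2 (card_le_univ W)
  have h7 : (#{z ∈ W | τ / 2 * #S ≤ (#(nbhd W S z \ B) : ℝ)} : ℝ) ≤
      #(excluded W (τ / 2 * #S) S T) := by
    exact_mod_cast card_le_card subset_union_right
  refine le_trans ?_ h7
  refine le_of_mul_le_mul_right ?_ hq
  have h8 : (#B : ℝ) * #S ≤ τ / 4 * N * #S := by gcongr
  have h9 : (#W : ℝ) * (τ / 2 * #S) ≤ N * (τ / 2 * #S) := by gcongr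
  linarith

theorem excluded_subset (W : Finset G) (t : ℝ) (S T : Finset G) : excluded W t S T ⊆ W := by
  refine union_subset (biUnion_subset.2 fun z _ => ?_) (filter_subset _ _)
  exact filter_subset _ _

/-- One step of the container algorithm: a progression-free subset of a dense set `W` has a
fingerprint of size `O(√|G|)` that determines, up to few choices, a positive proportion of `G` which
it avoids outside the fingerprint. -/
theorem exists_container_step {β : ℝ} (hβ : 0 < β) :
    ∃ δ : ℝ, 0 < δ ∧ ∃ K : ℝ, 0 < K ∧ ∃ N₀ : ℕ, ∀ (G : Type) [AddCommGroup G] [Fintype G] [DecidableEq G],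
      (Function.Injective fun x : G => x + x) → N₀ ≤ Fintype.card G →
      ∀ W : Finset G, β * Fintype.card G ≤ #W →
        ∃ 𝓓 : Finset G → Finset (Finset G), (∀ F, #(𝓓 F) ≤ 2 * 4 ^ #F) ∧
          (∀ F, ∀ D ∈ 𝓓 F, D ⊆ W ∧ δ * Fintype.card G ≤ #D) ∧
          ∀ I ⊆ W, ThreeAPFree (I : Set G) →
            ∃ F ⊆ I, (#F : ℝ) ≤ K * √(Fintype.card G) ∧ ∃ D ∈ 𝓓 F, I ⊆ F ∪ (W \ D) := by
  obtain ⟨τ, hτ, hτβ⟩ : ∃ τ, 0 < τ ∧ SimpleGraph.triangleRemovalBound (β / 9) * 27 = 4 * τ := by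
    have hc : 0 < SimpleGraph.triangleRemovalBound (β / 9) :=
      SimpleGraph.triangleRemovalBound_pos (by positivity)
    exact ⟨SimpleGraph.triangleRemovalBound (β / 9) * 27 / 4, by positivity, by ring⟩
  refine ⟨τ / 4, by positivity, 2 + 2 / τ, by positivity, ⌈1 / τ⌉₊ + 1, ?_⟩
  intro G _ _ _ h2 hN₀ W hW
  set N : ℝ := (Fintype.card G : ℝ) with hN
  have hN1 : 1 ≤ N := by
    rw [hN]
    exact_mod_cast (Nat.le_add_left 1 _).trans hN₀
  have hNτ : 1 ≤ τ * N := by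
    rw [mul_comm, ← div_le_iff₀ hτ]
    exact (Nat.le_ceil _).trans (Nat.cast_le.2 ((Nat.le_succ _).trans hN₀))
  have hWN : (#W : ℝ) ≤ N := Nat.cast_le.2 (card_le_univ W)
  set D₁ : Finset G := {a ∈ W | τ * N ≤ (#(link W a) : ℝ)} with hD₁
  -- Of the 4τN² progressions, at most N ≤ τN² are trivial and at most τN² start at an unpopular
  -- point.
  have hD₁card : τ * N ≤ #D₁ := by
    have h1 := card_threeAP_ge h2 hW
    have h3 : ((#{x ∈ W ×ˢ W | x.1 + x.1 - x.2 ∈ W} : ℕ) : ℝ) ≤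
        ∑ a ∈ W, (#(link W a) : ℝ) + #W := by
      exact_mod_cast card_filter_le_sum_link W
    have h4 := sum_le_card_filter_mul W (fun a => #(link W a)) (M := N) (t := τ * N)
      (by positivity) fun a _ => Nat.cast_le.2 (card_le_univ _)
    rw [hτβ] at h1
    refine le_of_mul_le_mul_right ?_ (zero_lt_one.trans_le hN1)
    have h5 : (#W : ℝ) * (τ * N) ≤ N * (τ * N) := by gcongr
    have h6 : N * 1 ≤ N * (τ * N) := by gcongr
    nlinarith [h1.trans h3]
  -- The fingerprint records only `S ∪ T`, so all pairs of subsets of `F` are allowed; `D₁` covers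
  -- the case where I has few popular points.
  refine ⟨fun F => {D ∈ insert D₁ ((F.powerset ×ˢ F.powerset).image
      fun x => excluded W (τ / 2 * #x.1) x.1 x.2) | D ⊆ W ∧ τ / 4 * N ≤ (#D : ℝ)},
    fun F => ?_, fun F D hD => (mem_filter.1 hD).2, fun I hIW hI => ?_⟩
  · refine (card_filter_le _ _).trans ((card_insert_le _ _).trans ?_)
    have h1 := card_image_le (s := F.powerset ×ˢ F.powerset)
      (f := fun x => excluded W (τ / 2 * #x.1) x.1 x.2)
    rw [card_product, card_powerset, ← mul_pow] at h1
    have h3 : 1 ≤ (2 * 2) ^ #F := Nat.one_le_pow _ _ (by norm_num)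
    norm_num at h1 h3
    omega
  have hs1 : 1 ≤ √N := Real.one_le_sqrt.2 hN1
  have hsq : √N * √N = N := Real.mul_self_sqrt (zero_le_one.trans hN1)
  set q := ⌈√N⌉₊ with hq
  have hq1 : √N ≤ q := Nat.le_ceil _
  have hq2 : (q : ℝ) ≤ 2 * √N := by
    have := Nat.ceil_lt_add_one (zero_le_one.trans hs1)
    linarith
  rcases le_or_gt (#(I ∩ D₁)) q with hcase | hcase
  · refine ⟨I ∩ D₁, inter_subset_left, ?_, D₁, ?_, fun x hx => ?_⟩
    · have h1 : (#(I ∩ D₁) : ℝ) ≤ q := Nat.cast_le.2 hcase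
      have h3 : 0 ≤ 2 / τ * √N := by positivity
      linarith
    · refine mem_filter.2 ⟨mem_insert_self _ _, filter_subset _ _, ?_⟩
      linarith
    · simp only [mem_union, mem_inter, mem_sdiff]
      have := hIW hx
      tauto
  · obtain ⟨S, hS, hSq⟩ := exists_subset_card_eq hcase.le
    have hSI : S ⊆ I := hS.trans inter_subset_left
    have hq0 : (0 : ℝ) < #S := by rw [hSq]; linarith
    have ht : 0 < τ / 2 * #S := by positivity
    obtain ⟨T, hTI, hTcard, hsat⟩ := exists_saturated W S I ht
    have hdisj := disjoint_excluded hI hSI hTI hsat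
    refine ⟨S ∪ T, union_subset hSI hTI, ?_, excluded W (τ / 2 * #S) S T, ?_, fun x hx => ?_⟩
    · have h1 : (#(S ∪ T) : ℝ) ≤ #S + #T := by exact_mod_cast card_union_le S T
      have h3 : (#T : ℝ) * (τ / 2 * √N) ≤ N := by
        calc (#T : ℝ) * (τ / 2 * √N) ≤ #T * (τ / 2 * #S) := by rw [hSq]; gcongr
          _ ≤ #(T.biUnion (nbhd W S)) := hTcard
          _ ≤ N := Nat.cast_le.2 (card_le_univ _)
      have h4 : (#T : ℝ) ≤ 2 / τ * √N := by
        refine le_of_mul_le_mul_right ?_ (show 0 < τ / 2 * √N by positivity)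
        calc (#T : ℝ) * (τ / 2 * √N) ≤ N := h3
          _ = √N * √N := hsq.symm
          _ = 2 / τ * √N * (τ / 2 * √N) := by field_simp
      rw [hSq] at h1
      linarith
    · refine mem_filter.2 ⟨mem_insert_of_mem (mem_image.2 ⟨(S, T), mem_product.2
        ⟨mem_powerset.2 subset_union_left, mem_powerset.2 subset_union_right⟩, rfl⟩),
        excluded_subset _ _ _ _, ?_⟩
      refine card_excluded_ge h2 (card_pos.1 (by exact_mod_cast hq0)) hτ.le (fun s hs => ?_) T
      exact (mem_filter.1 (mem_inter.1 (hS hs)).2).2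
    · exact mem_union_right _ (mem_sdiff.2 ⟨hIW hx, Finset.disjoint_left.1 hdisj hx⟩)

end Containers

/-! ### Iterating the step. -/

/-- Containers for sets without three-term progressions. -/
theorem exists_containers {β : ℝ} (hβ : 0 < β) :
    ∃ K : ℝ, 0 ≤ K ∧ ∃ k N₀ : ℕ, ∀ (G : Type) [AddCommGroup G] [Fintype G] [DecidableEq G],
      (Function.Injective fun x : G => x + x) → N₀ ≤ Fintype.card G →
        ∃ 𝓒 : Finset G → Finset (Finset G), (∀ F, #(𝓒 F) ≤ (2 * 16 ^ #F) ^ k) ∧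
          (∀ F, ∀ C ∈ 𝓒 F, (#C : ℝ) ≤ β * Fintype.card G) ∧
          ∀ I : Finset G, ThreeAPFree (I : Set G) →
            ∃ F ⊆ I, (#F : ℝ) ≤ K * √(Fintype.card G) ∧ ∃ C ∈ 𝓒 F, I ⊆ F ∪ C := by
  obtain ⟨δ, hδ, K, hK, N₀, hstep⟩ := exists_container_step hβ
  refine ⟨⌈1 / δ⌉₊ * K, by positivity, ⌈1 / δ⌉₊, N₀, ?_⟩
  intro G _ _ _ h2 hN₀
  set N : ℝ := (Fintype.card G : ℝ)
  have hiter : ∀ (k : ℕ) (W : Finset G), (#W : ℝ) ≤ β * N + k * (δ * N) →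
      ∃ 𝓒 : Finset G → Finset (Finset G), (∀ F, #(𝓒 F) ≤ (2 * 16 ^ #F) ^ k) ∧
        (∀ F, ∀ C ∈ 𝓒 F, (#C : ℝ) ≤ β * N) ∧
        ∀ I ⊆ W, ThreeAPFree (I : Set G) →
          ∃ F ⊆ I, (#F : ℝ) ≤ k * (K * √N) ∧ ∃ C ∈ 𝓒 F, I ⊆ F ∪ C := by
    intro k
    induction k with
    | zero =>
      intro W hW
      refine ⟨fun _ => {W}, by simp, ?_, fun I hI _ => ⟨∅, by simp, by simp, by simpa using hI⟩⟩
      simpa using hW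
    | succ k ih =>
      intro W hW
      rcases le_total (#W : ℝ) (β * N) with hWβ | hWβ
      · refine ⟨fun _ => {W}, fun F => ?_, by simpa using hWβ,
          fun I hI _ => ⟨∅, by simp, by simp; positivity, by simpa using hI⟩⟩
        rw [card_singleton]
        exact Nat.one_le_pow _ _ (by positivity)
      obtain ⟨𝓓, h𝓓card, h𝓓, h𝓓I⟩ := hstep G h2 hN₀ W hWβ
      choose! 𝓒 h𝓒card h𝓒 h𝓒I using ih
      have hsmall : ∀ F, ∀ D ∈ 𝓓 F, (#(W \ D) : ℝ) ≤ β * N + k * (δ * N) := by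
        intro F D hD
        obtain ⟨hDW, hD⟩ := h𝓓 F D hD
        rw [card_sdiff_of_subset hDW, Nat.cast_sub (card_le_card hDW)]
        push_cast at hW
        linarith
      -- Again only the union of the two fingerprints is kept: 4^#F pairs times 2·4^#F sets D give
      -- the factor 2·16^#F per round.
      refine ⟨fun F => (F.powerset ×ˢ F.powerset).biUnion fun x =>
        (𝓓 x.1).biUnion fun D => 𝓒 (W \ D) x.2, fun F => ?_, fun F C hC => ?_,
        fun I hIW hI => ?_⟩
      · calc _ ≤ #(F.powerset ×ˢ F.powerset) * (2 * 4 ^ #F * (2 * 16 ^ #F) ^ k) := by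
              refine card_biUnion_le_card_mul _ _ _ fun x hx => ?_
              rw [mem_product, mem_powerset, mem_powerset] at hx
              calc _ ≤ #(𝓓 x.1) * (2 * 16 ^ #F) ^ k := by
                    refine card_biUnion_le_card_mul _ _ _ fun D hD => ?_
                    refine (h𝓒card _ (hsmall _ D hD) _).trans ?_
                    gcongr
                    · norm_num
                    · exact hx.2
                _ ≤ _ := by
                    gcongr
                    refine (h𝓓card _).trans ?_
                    gcongr
                    · norm_num
                    · exact hx.1
          _ = 2 * 16 ^ #F * (2 * 16 ^ #F) ^ k := by
              rw [card_product, card_powerset, ← mul_assoc]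
              congr 1
              rw [← mul_pow, mul_left_comm, ← mul_pow]
              norm_num
          _ = _ := (pow_succ' _ _).symm
      · simp only [mem_biUnion] at hC
        obtain ⟨x, -, D, hD, hC⟩ := hC
        exact h𝓒 _ (hsmall _ D hD) _ C hC
      · obtain ⟨F₁, hF₁, hF₁K, D, hD, hID⟩ := h𝓓I I hIW hI
        obtain ⟨F₂, hF₂, hF₂K, C, hC, hIC⟩ := h𝓒I (W \ D) (hsmall _ D hD) (I ∩ (W \ D))
          inter_subset_right (hI.mono (by simp))
        refine ⟨F₁ ∪ F₂, union_subset hF₁ (hF₂.trans inter_subset_left), ?_, C, ?_, ?_⟩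
        · have : (#(F₁ ∪ F₂) : ℝ) ≤ #F₁ + #F₂ := by exact_mod_cast card_union_le F₁ F₂
          push_cast
          linarith
        · simp only [mem_biUnion]
          exact ⟨(F₁, F₂), mem_product.2
            ⟨mem_powerset.2 subset_union_left, mem_powerset.2 subset_union_right⟩, D, hD, hC⟩
        · intro x hx
          have h1 := hID hx
          have h3 := @hIC x
          simp only [mem_union, mem_inter] at h1 h3 ⊢
          tauto
  obtain ⟨𝓒, h1, h3, h4⟩ := hiter ⌈1 / δ⌉₊ univ (by
    have h1 : 1 ≤ ⌈1 / δ⌉₊ * δ := by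
      rw [← div_le_iff₀ hδ]
      exact Nat.le_ceil _
    have h3 : 0 ≤ N := Nat.cast_nonneg _
    have h4 : (#(univ : Finset G) : ℝ) = N := by rw [card_univ]
    rw [h4]
    nlinarith [mul_le_mul_of_nonneg_right h1 h3, mul_nonneg hβ.le h3])
  refine ⟨𝓒, h1, h3, fun I hI => ?_⟩
  simpa only [mul_assoc] using h4 I (subset_univ I) hI

/-! ### Counting progression-free sets. -/

theorem choose_le_pow_mul_choose {a b : ℕ} {ρ : ℝ} (hρ0 : 0 ≤ ρ) (hρ1 : ρ ≤ 1)
    (hab : (a : ℝ) ≤ ρ * b) (j : ℕ) : (a.choose j : ℝ) ≤ ρ ^ j * b.choose j := by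
  have key : (a.descFactorial j : ℝ) ≤ ρ ^ j * b.descFactorial j := by
    induction j with
    | zero => simp
    | succ j ih =>
      rw [Nat.descFactorial_succ, Nat.descFactorial_succ]
      push_cast
      have h : ((a - j : ℕ) : ℝ) ≤ ρ * (b - j : ℕ) := by
        rcases le_total a j with h | h
        · rw [Nat.sub_eq_zero_of_le h, Nat.cast_zero]
          positivity
        · have hab' : a ≤ b := by
            have : ρ * b ≤ 1 * b := by gcongr
            rw [one_mul] at this
            exact_mod_cast hab.trans this
          rw [Nat.cast_sub h, Nat.cast_sub (h.trans hab')]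
          nlinarith [mul_nonneg (sub_nonneg.2 hρ1) (Nat.cast_nonneg (α := ℝ) j)]
      calc ((a - j : ℕ) : ℝ) * a.descFactorial j
          ≤ (ρ * (b - j : ℕ)) * (ρ ^ j * b.descFactorial j) := by gcongr
        _ = _ := by ring
  rw [Nat.descFactorial_eq_factorial_mul_choose, Nat.descFactorial_eq_factorial_mul_choose] at key
  push_cast at key
  have hj : (0 : ℝ) < j.factorial := by exact_mod_cast j.factorial_pos
  refine le_of_mul_le_mul_left (key.trans_eq ?_) hj
  ring

open Classical in
/-- There are few progression-free sets of size `m`, once `m` exceeds a multiple of `√|G|`. -/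
theorem card_threeAPFree_le {η : ℝ} (hη : 0 < η) (hη1 : η ≤ 1) :
    ∃ L : ℝ, 1 ≤ L ∧ ∃ N₀ : ℕ, ∀ (G : Type) [AddCommGroup G] [Fintype G],
      (Function.Injective fun x : G => x + x) → N₀ ≤ Fintype.card G →
        ∀ m : ℕ, m ≤ Fintype.card G → L * √(Fintype.card G) ≤ m →
          (#((powersetCard m (univ : Finset G)).filter fun A : Finset G => ThreeAPFree (A : Set G)) : ℝ) ≤
            (4 * η) ^ m * (Fintype.card G).choose m := by
  obtain ⟨K, hK, k, N₀, hcont⟩ := exists_containers (β := η ^ 2 / 2) (by positivity)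
  -- Large enough that a fingerprint uses at most m/2 points and has at most 2^m containers.
  refine ⟨2 * K + k + 4 * k * K + 1, ?_, N₀ + 1, ?_⟩
  · have : 0 ≤ 2 * K + k + 4 * k * K := by positivity
    linarith
  intro G _ _ h2 hN₀ m hmN hm
  obtain ⟨𝓒, h𝓒card, h𝓒, h𝓒I⟩ := hcont G h2 ((Nat.le_succ _).trans hN₀)
  set n := Fintype.card G
  have hn1 : 1 ≤ √(n : ℝ) := Real.one_le_sqrt.2 (by exact_mod_cast (Nat.le_add_left 1 _).trans hN₀)
  set Q := ⌊K * √(n : ℝ)⌋₊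
  have hQ : (Q : ℝ) ≤ K * √n := Nat.floor_le (by positivity)
  have hkK : 0 ≤ k * K * √n := by positivity
  have hk0 : 0 ≤ (k : ℝ) * √n := by positivity
  have hKn : 0 ≤ K * √n := by positivity
  have hQm : 2 * Q ≤ m := by
    have : (2 * Q : ℝ) ≤ m := by nlinarith
    exact_mod_cast this
  have hQk : (1 + 4 * Q) * k ≤ m := by
    have h1 : (k : ℝ) * Q ≤ k * (K * √n) := by gcongr
    have h3 : (k : ℝ) * 1 ≤ k * √n := by gcongr
    have : ((1 + 4 * Q) * k : ℝ) ≤ m := by nlinarith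
    exact_mod_cast this
  have hsub : ((powersetCard m (univ : Finset G)).filter fun A : Finset G => ThreeAPFree (A : Set G)) ⊆
      (range (Q + 1)).biUnion fun s => (powersetCard s univ).biUnion fun F =>
        (𝓒 F).biUnion fun C => (powersetCard (m - s) C).image (F ∪ ·) := by
    intro A hA
    rw [mem_filter, mem_powersetCard] at hA
    obtain ⟨⟨-, hAm⟩, hA⟩ := hA
    obtain ⟨F, hFA, hFK, C, hC, hAC⟩ := h𝓒I A hA
    simp only [mem_biUnion, mem_range, mem_powersetCard, mem_image]
    refine ⟨#F, Nat.lt_succ_of_le (Nat.le_floor hFK), F, ⟨subset_univ _, rfl⟩, C, hC, A \ F,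
      ⟨sdiff_le_iff.2 hAC, ?_⟩, union_sdiff_of_subset hFA⟩
    rw [card_sdiff_of_subset hFA, hAm]
  have hterm : ∀ s ∈ range (Q + 1), ∀ F ∈ powersetCard s (univ : Finset G),
      (#((𝓒 F).biUnion fun C => (powersetCard (m - s) C).image (F ∪ ·)) : ℝ) ≤
        2 ^ m * (η ^ m * (n - s).choose (m - s)) := by
    intro s hs F hF
    rw [mem_powersetCard] at hF
    have hsQ : s ≤ Q := Nat.lt_succ_iff.1 (mem_range.1 hs)
    have h𝓒2 : #(𝓒 F) ≤ 2 ^ m := by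
      refine (h𝓒card F).trans ?_
      rw [hF.2]
      calc (2 * 16 ^ s) ^ k = 2 ^ ((1 + 4 * s) * k) := by
            rw [show 16 = 2 ^ 4 by norm_num, ← pow_mul, ← pow_succ', ← pow_mul, add_comm 1]
        _ ≤ 2 ^ m := by
            refine Nat.pow_le_pow_right (by norm_num) (le_trans ?_ hQk)
            gcongr
    have hC : ∀ C ∈ 𝓒 F, (#((powersetCard (m - s) C).image (F ∪ ·)) : ℝ) ≤
        η ^ m * (n - s).choose (m - s) := by
      intro C hC
      have h1 : #((powersetCard (m - s) C).image (F ∪ ·)) ≤ (#C).choose (m - s) :=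
        card_image_le.trans_eq (card_powersetCard _ _)
      -- Here n - s ≥ n/2 absorbs the 1/2 in β = η²/2; the square is spent on m - s ≥ m/2.
      have h3 : (#C : ℝ) ≤ η ^ 2 * (n - s : ℕ) := by
        refine (h𝓒 F C hC).trans ?_
        have h5 : (2 * s : ℝ) ≤ n := by exact_mod_cast (by omega : 2 * s ≤ n)
        rw [Nat.cast_sub (by omega)]
        nlinarith [sq_nonneg η]
      calc (#((powersetCard (m - s) C).image (F ∪ ·)) : ℝ)
          ≤ (#C).choose (m - s) := by exact_mod_cast h1
        _ ≤ (η ^ 2) ^ (m - s) * (n - s).choose (m - s) :=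
            choose_le_pow_mul_choose (by positivity) (pow_le_one₀ hη.le hη1) h3 _
        _ ≤ _ := by
            rw [← pow_mul]
            gcongr ?_ * _
            exact pow_le_pow_of_le_one hη.le hη1 (by omega)
    calc (#((𝓒 F).biUnion fun C => (powersetCard (m - s) C).image (F ∪ ·)) : ℝ)
        ≤ ∑ C ∈ 𝓒 F, (#((powersetCard (m - s) C).image (F ∪ ·)) : ℝ) := by
          exact_mod_cast card_biUnion_le
      _ ≤ #(𝓒 F) • (η ^ m * (n - s).choose (m - s)) := sum_le_card_nsmul _ _ _ hC
      _ ≤ _ := by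
          rw [nsmul_eq_mul]
          gcongr
          exact_mod_cast h𝓒2
  calc (#((powersetCard m (univ : Finset G)).filter fun A : Finset G => ThreeAPFree (A : Set G)) : ℝ)
      ≤ ∑ s ∈ range (Q + 1), ∑ F ∈ powersetCard s (univ : Finset G),
          (#((𝓒 F).biUnion fun C => (powersetCard (m - s) C).image (F ∪ ·)) : ℝ) := by
        exact_mod_cast (card_le_card hsub).trans
          (card_biUnion_le.trans (sum_le_sum fun s _ => card_biUnion_le))
    _ ≤ ∑ s ∈ range (Q + 1), (2 * η) ^ m * n.choose m * m.choose s := by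
        refine sum_le_sum fun s hs => (sum_le_card_nsmul _ _ _ (hterm s hs)).trans_eq ?_
        have hsm : s ≤ m := by
          have := mem_range.1 hs
          omega
        have := congrArg (Nat.cast (R := ℝ)) (Nat.choose_mul (n := n) hsm)
        push_cast at this
        rw [card_powersetCard, card_univ, nsmul_eq_mul, mul_assoc _ (n.choose m : ℝ), this, mul_pow]
        ring
    _ = (2 * η) ^ m * n.choose m * ∑ s ∈ range (Q + 1), (m.choose s : ℝ) := by rw [mul_sum]
    _ ≤ (2 * η) ^ m * n.choose m * 2 ^ m := by
        gcongr
        rw [← Nat.cast_sum]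
        have h1 : ∑ s ∈ range (Q + 1), m.choose s ≤ ∑ s ∈ range (m + 1), m.choose s :=
          sum_le_sum_of_subset (range_subset_range.2 (by omega))
        rw [Nat.sum_range_choose] at h1
        exact_mod_cast h1
    _ = _ := by
        rw [show 4 * η = 2 * η * 2 by ring, mul_pow (2 * η)]
        ring

open Classical in
-- The first-moment bound.
/-- A set that is not `(α, 3AP)`-dense contains a progression-free set of size `⌈α r⌉`. -/
theorem card_not_isThreeAPDense_le {G : Type*} [AddCommGroup G] [Fintype G] {α : ℝ} (r : ℕ) :
    #{R ∈ powersetCard r (univ : Finset G) | ¬ IsThreeAPDense α R} ≤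
      #((powersetCard ⌈α * r⌉₊ (univ : Finset G)).filter fun A : Finset G => ThreeAPFree (A : Set G)) *
        (Fintype.card G - ⌈α * r⌉₊).choose (r - ⌈α * r⌉₊) := by
  set m := ⌈α * r⌉₊
  have hsub : {R ∈ powersetCard r (univ : Finset G) | ¬ IsThreeAPDense α R} ⊆
      ((powersetCard m (univ : Finset G)).filter fun A : Finset G => ThreeAPFree (A : Set G)).biUnion fun A =>
        (powersetCard (r - m) (univ \ A)).image (A ∪ ·) := by
    intro R hR
    simp only [mem_filter, mem_powersetCard, IsThreeAPDense, not_forall, not_not] at hR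
    obtain ⟨⟨-, hRr⟩, B, hBR, hBα, hB⟩ := hR
    rw [hRr] at hBα
    obtain ⟨A, hAB, hAm⟩ := exists_subset_card_eq (Nat.ceil_le.2 hBα)
    simp only [mem_biUnion, mem_filter, mem_powersetCard, mem_image]
    refine ⟨A, ⟨⟨subset_univ _, hAm⟩, hB.mono (by exact_mod_cast hAB)⟩, R \ A,
      ⟨sdiff_subset_sdiff (subset_univ _) le_rfl, ?_⟩, union_sdiff_of_subset (hAB.trans hBR)⟩
    rw [card_sdiff_of_subset (hAB.trans hBR), hRr, hAm]
  refine (card_le_card hsub).trans (card_biUnion_le_card_mul _ _ _ fun A hA => ?_)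
  rw [mem_filter, mem_powersetCard] at hA
  refine card_image_le.trans_eq ?_
  rw [card_powersetCard, card_sdiff_of_subset (subset_univ _), hA.1.2, card_univ]

theorem exists_probNotThreeAPDense_le {α : ℝ} (hα : 0 < α) :
    ∃ C : ℝ, 0 < C ∧ ∃ N₀ : ℕ, ∀ (G : Type) [AddCommGroup G] [Fintype G],
      (Function.Injective fun x : G => x + x) → N₀ ≤ Fintype.card G →
        ∀ r : ℕ, r ≤ Fintype.card G → C * √(Fintype.card G) ≤ r →
          probNotThreeAPDense G α r ≤ (1 / 2) ^ ⌈√(Fintype.card G : ℝ)⌉₊ := by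
  classical
  set a := ⌈1 / α⌉₊
  -- As r ≤ am, C(r,m) ≤ 2^(am), and this η makes 4η·2^a = 1/2.
  obtain ⟨L, hL, N₀, hcount⟩ := card_threeAPFree_le (η := 1 / (8 * 2 ^ a)) (by positivity) (by
    have : (1 : ℝ) ≤ 2 ^ a := one_le_pow₀ (by norm_num)
    rw [div_le_one (by positivity)]
    linarith)
  refine ⟨L / α, by positivity, N₀, fun G _ _ h2 hN₀ r hr hCr => ?_⟩
  set n := Fintype.card G
  set m := ⌈α * r⌉₊
  have hαr : α * r ≤ m := Nat.le_ceil _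
  have hLm : L * √n ≤ m := by
    rw [div_mul_eq_mul_div, div_le_iff₀ hα, mul_comm _ α] at hCr
    exact hCr.trans hαr
  have hnm : ⌈√(n : ℝ)⌉₊ ≤ m := by
    refine Nat.ceil_le.2 (le_trans ?_ hLm)
    nlinarith [Real.sqrt_nonneg (n : ℝ)]
  have hram : r ≤ a * m := by
    have h1 : 1 / α ≤ a := Nat.le_ceil _
    have h3 : (r : ℝ) ≤ a * m := by
      calc (r : ℝ) = 1 / α * (α * r) := by field_simp
        _ ≤ a * m := by gcongr
    exact_mod_cast h3
  have hpos : (0 : ℝ) < n.choose r := by exact_mod_cast Nat.choose_pos hr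
  have hbad := card_not_isThreeAPDense_le (G := G) (α := α) r
  have hprob : probNotThreeAPDense G α r =
      (#{R ∈ powersetCard r (univ : Finset G) | ¬ IsThreeAPDense α R} : ℝ) / n.choose r := by
    rw [probNotThreeAPDense, card_powersetCard, card_univ]
  rw [hprob, div_le_iff₀ hpos]
  rcases le_or_gt m r with hmr | hmr
  · calc (#{R ∈ powersetCard r (univ : Finset G) | ¬ IsThreeAPDense α R} : ℝ)
        ≤ #((powersetCard m (univ : Finset G)).filter fun A : Finset G => ThreeAPFree (A : Set G)) *
          (n - m).choose (r - m) := by exact_mod_cast hbad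
      _ ≤ (4 * (1 / (8 * 2 ^ a))) ^ m * n.choose m * (n - m).choose (r - m) := by
          gcongr
          exact hcount G h2 hN₀ m (hmr.trans hr) hLm
      _ = (4 * (1 / (8 * 2 ^ a))) ^ m * (n.choose r * r.choose m) := by
          have := congrArg (Nat.cast (R := ℝ)) (Nat.choose_mul (n := n) (k := r) hmr)
          push_cast at this
          rw [this, mul_assoc]
      _ ≤ (4 * (1 / (8 * 2 ^ a))) ^ m * (n.choose r * (2 ^ a) ^ m) := by
          gcongr
          rw [← pow_mul]
          exact_mod_cast (Nat.choose_le_two_pow r m).trans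
            (Nat.pow_le_pow_right (by norm_num) hram)
      _ = (1 / 2) ^ m * n.choose r := by
          rw [mul_left_comm, ← mul_pow, mul_comm]
          congr 2
          field_simp
          norm_num
      _ ≤ _ := by
          gcongr ?_ * _
          exact pow_le_pow_of_le_one (by norm_num) (by norm_num) hnm
  -- When m > r, no subset of `R` is large enough to violate density.
  · suffices #{R ∈ powersetCard r (univ : Finset G) | ¬ IsThreeAPDense α R} = 0 by
      rw [this, Nat.cast_zero]
      positivity
    rw [card_eq_zero, filter_eq_empty_iff]
    intro R hR hRd
    simp only [mem_powersetCard, IsThreeAPDense, not_forall, not_not] at hR hRd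
    obtain ⟨A, hA, hAα, -⟩ := hRd
    have h1 := Nat.ceil_le.2 hAα
    have h3 := card_le_card hA
    rw [hR.2] at h1 h3
    exact absurd (h1.trans h3) hmr.not_ge

end RandomRoth

theorem mainTheorem1 (α : ℝ) (hα : 0 < α) :
    ∃ C : ℝ, 0 < C ∧
      ∀ (p : ℕ) [Fact p.Prime], p ≠ 2 →
        ∀ ε : ℝ, 0 < ε → ∃ n₀ : ℕ, ∀ n : ℕ, n₀ ≤ n →
          ∀ r : ℕ, r ≤ Fintype.card (Fin n → ZMod p) →
            C * Real.sqrt (Fintype.card (Fin n → ZMod p) : ℝ) ≤ (r : ℝ) →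
              probNotThreeAPDense (Fin n → ZMod p) α r ≤ ε := by
  obtain ⟨C, hC, N₀, h⟩ := RandomRoth.exists_probNotThreeAPDense_le hα
  refine ⟨C, hC, fun p hp hp2 ε hε => ?_⟩
  obtain ⟨m₀, hm₀⟩ := exists_pow_lt_of_lt_one hε (by norm_num : (1 / 2 : ℝ) < 1)
  refine ⟨max N₀ (m₀ ^ 2), fun n hn r hr hCr => ?_⟩
  have hcard : n ≤ Fintype.card (Fin n → ZMod p) := by
    rw [Fintype.card_fun, ZMod.card, Fintype.card_fin]
    exact (Nat.lt_pow_self hp.out.one_lt).le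
  have h2 : Function.Injective fun x : Fin n → ZMod p => x + x := by
    have : (2 : ZMod p) ≠ 0 := Ring.two_ne_zero (by rwa [ZMod.ringChar_zmod_n])
    intro x y hxy
    ext1 i
    have hi := congrFun hxy i
    simp only [Pi.add_apply, ← two_mul] at hi
    exact mul_left_cancel₀ this hi
  refine (h _ h2 ((le_max_left _ _).trans (hn.trans hcard)) r hr hCr).trans (le_trans ?_ hm₀.le)
  refine pow_le_pow_of_le_one (by norm_num) (by norm_num) ?_
  rw [← Nat.cast_le (α := ℝ)]
  refine le_trans (Real.le_sqrt_of_sq_le ?_) (Nat.le_ceil _)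
  exact_mod_cast (le_max_right _ _).trans (hn.trans hcard)
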